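/- Let $m\ge 1$. For an increasing sequence of positive integers $(a_n)_{n\ge 0}$, put $b_0=[a_0]$ and $b_k=[a_{m(k-1)+1},\dots,a_{mk}]$ for $k\ge 1$ (the bins). A legal $m$-gonal decomposition of $z$ is a representation $z=a_{\ell_1}+\cdots+a_{\ell_k}$ with $\ell_1<\cdots<\ell_k$ in which no two summands lie in the same bin (the integer $0$ has the empty decomposition). Let $(a_n)$ be the $m$-gonal sequence, that is, the increasing sequence of positive integers in which each $a_i$ is the smallest positive integer that has no legal $m$-gonal decomposition using only $a_0,\dots,a_{i-1}$; every non-negative integer $z$ then has a unique legal decomposition $z=a_{\ell_1}+\cdots+a_{\ell_{k(z)}}$, where $\ell_j=\ell_j(z)$. Let $I_n=\{0,1,\dots,a_{mn+1}-1\}$. For $z\in I_n$ with $k(z)\ge 2$ let $$\nu_{z,n}=\frac1{k(z)-1}\sum_{j=2}^{k(z)}\delta_{\ell_j-\ell_{j-1}}$$ be its individual spacing gap measure (the zero measure if $k(z)\le 1$). Let $N_{\rm gaps}(n)=\sum_{z=1}^{a_{mn+1}-1}(k(z)-1)$, let $$\nu_n=\frac1{N_{\rm gaps}(n)}\sum_{z=1}^{a_{mn+1}-1}\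 \sum_{j=2}^{k(z)}\delta_{\ell_j-\ell_{j-1}}$$ be the average spacing gap measure, and let $P_n(g)=\nu_n(\{g\})$ be the proportion of gaps of length $g$ among all these gaps. Then there is a probability measure $\nu$ on $\mathbb R$, the limiting average gap measure, such that $\nu_n\to\nu$ weakly and $P_n(g)\to\nu(\{g\})$ for every integer $g\ge 0$ as $n\to\infty$, and the individual gap measures converge to $\nu$ almost surely in distribution: whenever $Z_1,Z_2,\dots$ are random variables on a common probability space (with any joint distribution) such that each $Z_n$ is uniformly distributed on $I_n$, then with probability $1$ the measures $\nu_{Z_n,n}$ converge weakly to $\nu$ as $n\to\infty$. -/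

import Mathlib

open MeasureTheory ProbabilityTheory Filter
open scoped Topology NNReal

namespace MGonal

/-- The number of the bin that contains the term of index `i`: the bin `b_0` holds the index `0`,
and for `k ≥ 1` the bin `b_k` holds the `m` indices `m * (k - 1) + 1, …, m * k`. -/
def bin (m i : ℕ) : ℕ := if i = 0 then 0 else (i - 1) / m + 1

/-- A set of indices is legal if no two of its elements lie in the same bin. -/
def Legal (m : ℕ) (S : Finset ℕ) : Prop :=
  ∀ i ∈ S, ∀ j ∈ S, bin m i = bin m j → i = j

/-- `S` is the index set of a legal `m`-gonal decomposition of `z` with respect to `a`. -/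
def IsDecomp (m : ℕ) (a : ℕ → ℕ) (z : ℕ) (S : Finset ℕ) : Prop :=
  Legal m S ∧ ∑ i ∈ S, a i = z

/-- `a` is an `m`-gonal sequence: an increasing sequence of positive integers such that every `a i`
is the smallest positive integer without a legal decomposition using only `a 0, …, a (i - 1)`. -/
def IsMGonalSeq (m : ℕ) (a : ℕ → ℕ) : Prop :=
  StrictMono a ∧ (∀ i, 0 < a i) ∧
    ∀ i, IsLeast {z : ℕ | 0 < z ∧ ¬ ∃ S ⊆ Finset.range i, IsDecomp m a z S} (a i)

open Classical in
/-- The index set `{ℓ_1 < ⋯ < ℓ_k}` of the legal decomposition of `z`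
(for an `m`-gonal sequence there is exactly one). -/
noncomputable def decomp (m : ℕ) (a : ℕ → ℕ) (z : ℕ) : Finset ℕ :=
  if h : ∃ S, IsDecomp m a z S then h.choose else ∅

/-- The number `k(z)` of summands in the legal decomposition of `z`. -/
noncomputable def numSummands (m : ℕ) (a : ℕ → ℕ) (z : ℕ) : ℕ := (decomp m a z).card

/-- The pairs `(ℓ_{j-1}, ℓ_j)` of consecutive elements of a finite set of indices. -/
def consecutive (S : Finset ℕ) : Finset (ℕ × ℕ) :=
  (S ×ˢ S).filter fun p => p.1 < p.2 ∧ ∀ k ∈ S, ¬ (p.1 < k ∧ k < p.2)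

/-- The sum of the unit point masses at the gaps `ℓ_j - ℓ_{j-1}` of `z`, with multiplicity. -/
noncomputable def gapSum (m : ℕ) (a : ℕ → ℕ) (z : ℕ) : FiniteMeasure ℝ :=
  ∑ p ∈ consecutive (decomp m a z), (diracProba ((p.2 : ℝ) - (p.1 : ℝ))).toFiniteMeasure

/-- The spacing gap measure `ν_{z,n}` of `z`, a probability measure on `ℝ` whenever `z` has at
least two summands, and the zero measure otherwise. (It depends on `n` only through `z ∈ I_n`.) -/
noncomputable def gapMeasure (m : ℕ) (a : ℕ → ℕ) (z : ℕ) : FiniteMeasure ℝ :=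
  ((numSummands m a z - 1 : ℕ) : ℝ≥0)⁻¹ • gapSum m a z

/-- The total number of gaps in the decompositions of all positive `z < a_{mn+1}`. -/
noncomputable def totalGaps (m : ℕ) (a : ℕ → ℕ) (n : ℕ) : ℕ :=
  ∑ z ∈ Finset.Ico (a 0) (a (m * n + 1)), (numSummands m a z - 1)

/-- The average spacing gap measure `ν_n`. -/
noncomputable def avgGapMeasure (m : ℕ) (a : ℕ → ℕ) (n : ℕ) : FiniteMeasure ℝ :=
  (totalGaps m a n : ℝ≥0)⁻¹ • ∑ z ∈ Finset.Ico (a 0) (a (m * n + 1)), gapSum m a z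

/-- `P_n(g)`: the fraction of the gaps of all positive `z < a_{mn+1}` that have length `g`. -/
noncomputable def gapProb (m : ℕ) (a : ℕ → ℕ) (n g : ℕ) : ℝ≥0 :=
  (totalGaps m a n : ℝ≥0)⁻¹ * ∑ z ∈ Finset.Ico (a 0) (a (m * n + 1)),
    (((consecutive (decomp m a z)).filter fun p => p.2 = p.1 + g).card : ℝ≥0)

end MGonal

/-!
The terms of an `m`-gonal sequence satisfy `a (i + 1) = a i + a s`, where `s` is the first index of
the bin of `i`. Hence `a (m * n + d) = d * (2 * (m + 1) ^ n)` for `1 ≤ d ≤ m + 1`, and the legal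
decomposition of `z` reads off the parity of `z` and the digits of `z / 2` in base `m + 1`: a
nonzero digit `d` in position `n` contributes the index `m * n + d` (`decomp_add_digit`). For
uniform `z < a (m * n + 1)` the digits are independent and uniform, so the decomposition is a
random string, and what is needed is a law of large numbers, with errors summable in `n`, for the
number of summands and for the number of gaps of each length `g`.

Both are controlled by martingales along the digits (`IsDigitMartingale`). The number of
summands minus `n * summandRate m` is one. The number of gaps of length `g` becomes one after
subtracting `n * gapRate m g` and adding the conditional probability that the gap still open after
`n` digits will have length `g` (`gap_martingale`). The increments are bounded, so an exponential
moment estimate and Chernoff's bound make linear deviations exponentially unlikely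
(`IsDigitMartingale.card_le`), and the Borel–Cantelli lemma gives almost sure convergence whatever
the joint distribution of the `Z n` (`IsDigitMartingale.ae_tendsto`). Constancy of the mean of a
martingale gives the averages over all `z` (`IsDigitMartingale.tendsto_average`).

The limiting proportions `gapRate m g / summandRate m` add up to `1` (`hasSum_gapRate`), so they
are the point masses of a probability measure on `ℕ`, and convergence of all point masses and of
the total mass implies weak convergence (`tendsto_of_tendsto_singleton`).
-/

namespace MGonal

variable {m : ℕ} {a : ℕ → ℕ}

/-! ### The sequence and its decompositions -/

/-- The first index of the bin that contains the index `i`. -/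
def binStart (m i : ℕ) : ℕ := if i = 0 then 0 else m * ((i - 1) / m) + 1

lemma binStart_le (m i : ℕ) : binStart m i ≤ i := by
  unfold binStart
  split_ifs with h
  · omega
  · have := Nat.mul_div_le (i - 1) m
    omega

lemma bin_ne_of_lt_binStart {m i k : ℕ} (hm : 1 ≤ m) (h : k < binStart m i) :
    bin m k ≠ bin m i := by
  unfold binStart at h
  unfold bin
  split_ifs at h with hi
  · omega
  · rw [if_neg hi]
    split_ifs with hk
    · exact (Nat.succ_ne_zero _).symm
    · have : (k - 1) / m < (i - 1) / m := by
        rw [Nat.div_lt_iff_lt_mul hm, mul_comm]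
        omega
      omega

lemma lt_binStart {m i k : ℕ} (hm : 1 ≤ m) (hki : k < i) (h : bin m k ≠ bin m i) :
    k < binStart m i := by
  unfold binStart
  unfold bin at h
  split_ifs at h ⊢ with hk hi
  · omega
  · omega
  · omega
  · have h1 : (k - 1) / m ≤ (i - 1) / m := Nat.div_le_div_right (by omega)
    have : (k - 1) / m < (i - 1) / m := by omega
    rw [Nat.div_lt_iff_lt_mul hm, mul_comm] at this
    omega

lemma Legal.subset {m : ℕ} {S T : Finset ℕ} (hT : Legal m T) (h : S ⊆ T) : Legal m S :=
  fun i hi j hj => hT i (h hi) j (h hj)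

lemma Legal.insert {m i : ℕ} {S : Finset ℕ} (hm : 1 ≤ m) (hS : Legal m S)
    (h : S ⊆ Finset.range (binStart m i)) : Legal m (insert i S) := by
  intro x hx y hy hxy
  rw [Finset.mem_insert] at hx hy
  rcases hx with rfl | hx <;> rcases hy with rfl | hy
  · rfl
  · exact absurd hxy.symm (bin_ne_of_lt_binStart hm (Finset.mem_range.1 (h hy)))
  · exact absurd hxy (bin_ne_of_lt_binStart hm (Finset.mem_range.1 (h hx)))
  · exact hS x hx y hy hxy

lemma Legal.erase_subset_range {m i : ℕ} {S : Finset ℕ} (hm : 1 ≤ m) (hS : Legal m S)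
    (hi : i ∈ S) (h : S ⊆ Finset.range (i + 1)) :
    S.erase i ⊆ Finset.range (binStart m i) := by
  intro k hk
  rw [Finset.mem_erase] at hk
  have h1 := Finset.mem_range.1 (h hk.2)
  exact Finset.mem_range.2
    (lt_binStart hm (by omega) fun hb => hk.1 (hS k hk.2 i hi hb))

lemma IsMGonalSeq.exists_decomp_of_lt (ha : IsMGonalSeq m a) {i z : ℕ} (hz : z < a i) :
    ∃ S ⊆ Finset.range i, IsDecomp m a z S := by
  rcases Nat.eq_zero_or_pos z with rfl | hpos
  · exact ⟨∅, by simp, by simp [Legal], by simp⟩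
  · by_contra h
    exact absurd ((ha.2.2 i).2 ⟨hpos, h⟩) (by omega)

/-- Adding `a i` to the sums over earlier bins keeps decompositions legal, so the next term of
the sequence cannot be smaller than `a i + a (binStart m i)`. -/
lemma IsMGonalSeq.add_le_succ (hm : 1 ≤ m) (ha : IsMGonalSeq m a) (i : ℕ) :
    a i + a (binStart m i) ≤ a (i + 1) := by
  by_contra! hlt
  refine (ha.2.2 (i + 1)).1.2 ?_
  have hmono : a i < a (i + 1) := ha.1 (Nat.lt_succ_self i)
  obtain ⟨S, hS, hl, hs⟩ := ha.exists_decomp_of_lt (i := binStart m i) (z := a (i + 1) - a i)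
    (by omega)
  have hle := binStart_le m i
  have hi : i ∉ S := fun h => by
    have := Finset.mem_range.1 (hS h)
    omega
  refine ⟨insert i S, ?_, hl.insert hm hS, ?_⟩
  · intro x hx
    rcases Finset.mem_insert.1 hx with rfl | hx
    · simp
    · have := Finset.mem_range.1 (hS hx)
      exact Finset.mem_range.2 (by omega)
  · rw [Finset.sum_insert hi, hs]
    omega

/-- Legal sums of terms before `a i` are smaller than `a i`. -/
lemma IsMGonalSeq.sum_lt (hm : 1 ≤ m) (ha : IsMGonalSeq m a) (i : ℕ) :
    ∀ S ⊆ Finset.range i, Legal m S → ∑ j ∈ S, a j < a i := by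
  induction i using Nat.strong_induction_on with
  | _ i ih =>
    intro S hS hl
    rcases i with _ | i
    · have : S = ∅ := by simpa using hS
      simpa [this] using ha.2.1 0
    · by_cases hi : i ∈ S
      · have h1 := ih (binStart m i) (Nat.lt_succ_of_le (binStart_le m i)) _
          (hl.erase_subset_range hm hi hS) (hl.subset (Finset.erase_subset i S))
        have h2 := ha.add_le_succ hm i
        rw [← Finset.add_sum_erase S a hi]
        omega
      · have h1 : S ⊆ Finset.range i := by
          intro x hx
          have := Finset.mem_range.1 (hS hx)
          have : x ≠ i := fun h => hi (h ▸ hx)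
          exact Finset.mem_range.2 (by omega)
        exact (ih i (Nat.lt_succ_self i) S h1 hl).trans (ha.1 (Nat.lt_succ_self i))

lemma IsMGonalSeq.succ_eq (hm : 1 ≤ m) (ha : IsMGonalSeq m a) (i : ℕ) :
    a (i + 1) = a i + a (binStart m i) := by
  refine le_antisymm ((ha.2.2 (i + 1)).2 ⟨?_, ?_⟩) (ha.add_le_succ hm i)
  · have := ha.2.1 i
    omega
  · rintro ⟨S, hS, hl, hs⟩
    by_cases hi : i ∈ S
    · have h1 := ha.sum_lt hm _ _ (hl.erase_subset_range hm hi hS)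
        (hl.subset (Finset.erase_subset i S))
      rw [← Finset.add_sum_erase S a hi] at hs
      omega
    · have h1 : S ⊆ Finset.range i := by
        intro x hx
        have := Finset.mem_range.1 (hS hx)
        have : x ≠ i := fun h => hi (h ▸ hx)
        exact Finset.mem_range.2 (by omega)
      have := ha.sum_lt hm i S h1 hl
      omega

lemma IsMGonalSeq.zero_eq (ha : IsMGonalSeq m a) : a 0 = 1 := by
  refine le_antisymm ((ha.2.2 0).2 ⟨one_pos, ?_⟩) (ha.2.1 0)
  rintro ⟨S, hS, -, hs⟩
  have : S = ∅ := by simpa using hS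
  simp [this] at hs

lemma binStart_mul_add (n : ℕ) {d : ℕ} (hd : 1 ≤ d) (hdm : d ≤ m) :
    binStart m (m * n + d) = m * n + 1 := by
  have : (m * n + d - 1) / m = n := by
    rw [show m * n + d - 1 = (d - 1) + m * n by omega, Nat.add_mul_div_left _ _ (by omega),
      Nat.div_eq_of_lt (by omega), zero_add]
  rw [binStart, if_neg (by omega), this]

lemma IsMGonalSeq.apply_mul_add (hm : 1 ≤ m) (ha : IsMGonalSeq m a) (n d : ℕ) (hd : d ≤ m) :
    a (m * n + (d + 1)) = (d + 1) * a (m * n + 1) := by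
  induction d with
  | zero => simp
  | succ d ih =>
    rw [show m * n + (d + 1 + 1) = (m * n + (d + 1)) + 1 by omega, ha.succ_eq hm,
      binStart_mul_add n (by omega) (by omega), ih (by omega)]
    ring

lemma IsMGonalSeq.apply_mul_add_one (hm : 1 ≤ m) (ha : IsMGonalSeq m a) (n : ℕ) :
    a (m * n + 1) = 2 * (m + 1) ^ n := by
  induction n with
  | zero =>
    rw [mul_zero, ha.succ_eq hm, show binStart m 0 = 0 from rfl, ha.zero_eq]
    simp
  | succ n ih =>
    rw [show m * (n + 1) + 1 = m * n + (m + 1) by ring, ha.apply_mul_add hm n m le_rfl, ih]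
    ring

/-- The largest index of a legal decomposition is determined by the sum, since
`a i ≤ z < a (i + 1)`; removing it and inducting gives uniqueness. -/
lemma IsDecomp.unique (hm : 1 ≤ m) (ha : IsMGonalSeq m a) {z : ℕ} :
    ∀ {S T : Finset ℕ}, IsDecomp m a z S → IsDecomp m a z T → S = T := by
  induction z using Nat.strong_induction_on with
  | _ z ih =>
    intro S T hS hT
    rcases Nat.eq_zero_or_pos z with rfl | hz
    · have key : ∀ U : Finset ℕ, IsDecomp m a 0 U → U = ∅ := by
        intro U hU
        refine Finset.eq_empty_of_forall_notMem fun i hi => ?_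
        have := Finset.sum_eq_zero_iff.1 hU.2 i hi
        exact (ha.2.1 i).ne' this
      rw [key S hS, key T hT]
    · have key : ∀ U : Finset ℕ, IsDecomp m a z U →
          ∃ i ∈ U, a i ≤ z ∧ z < a (i + 1) ∧ U ⊆ Finset.range (i + 1) := by
        intro U hU
        have hne : U.Nonempty := by
          rw [Finset.nonempty_iff_ne_empty]
          rintro rfl
          have := hU.2
          simp at this
          omega
        have hsub : U ⊆ Finset.range (U.max' hne + 1) := fun x hx =>
          Finset.mem_range.2 (Nat.lt_succ_of_le (U.le_max' x hx))
        refine ⟨U.max' hne, U.max'_mem hne, ?_, ?_, hsub⟩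
        · rw [← hU.2]
          exact Finset.single_le_sum (f := a) (fun _ _ => Nat.zero_le _) (U.max'_mem hne)
        · rw [← hU.2]
          exact ha.sum_lt hm _ U hsub hU.1
      obtain ⟨i, hi, h1, h2, -⟩ := key S hS
      obtain ⟨j, hj, h3, h4, -⟩ := key T hT
      have hij : i = j := by
        have h5 := ha.1.lt_iff_lt.1 (h1.trans_lt h4)
        have h6 := ha.1.lt_iff_lt.1 (h3.trans_lt h2)
        omega
      subst hij
      have hpos := ha.2.1 i
      have he : S.erase i = T.erase i := by
        refine ih (z - a i) (by omega) ⟨hS.1.subset (Finset.erase_subset _ _), ?_⟩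
          ⟨hT.1.subset (Finset.erase_subset _ _), ?_⟩
        · have := Finset.add_sum_erase S a hi
          have := hS.2
          omega
        · have := Finset.add_sum_erase T a hj
          have := hT.2
          omega
      rw [← Finset.insert_erase hi, he, Finset.insert_erase hj]

lemma isDecomp_decomp (ha : IsMGonalSeq m a) (z : ℕ) : IsDecomp m a z (decomp m a z) := by
  have h : ∃ S, IsDecomp m a z S := by
    obtain ⟨S, -, hS⟩ := ha.exists_decomp_of_lt (i := z + 1) (z := z)
      ((Nat.lt_succ_self z).trans_le ha.1.le_apply)
    exact ⟨S, hS⟩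
  rw [decomp, dif_pos h]
  exact h.choose_spec

lemma decomp_eq (hm : 1 ≤ m) (ha : IsMGonalSeq m a) {z : ℕ} {S : Finset ℕ}
    (h : IsDecomp m a z S) : decomp m a z = S :=
  (isDecomp_decomp ha z).unique hm ha h

lemma decomp_zero (hm : 1 ≤ m) (ha : IsMGonalSeq m a) : decomp m a 0 = ∅ :=
  decomp_eq hm ha ⟨by simp [Legal], by simp⟩

lemma decomp_subset_range (ha : IsMGonalSeq m a) {z i : ℕ} (hz : z < a i) :
    decomp m a z ⊆ Finset.range i := by
  intro j hj
  have h1 : a j ≤ ∑ i ∈ decomp m a z, a i :=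
    Finset.single_le_sum (f := a) (fun _ _ => Nat.zero_le _) hj
  rw [(isDecomp_decomp ha z).2] at h1
  exact Finset.mem_range.2 (ha.1.lt_iff_lt.1 (h1.trans_lt hz))

lemma decomp_nonempty (ha : IsMGonalSeq m a) {z : ℕ} (hz : z ≠ 0) : (decomp m a z).Nonempty := by
  rw [Finset.nonempty_iff_ne_empty]
  intro h
  have := (isDecomp_decomp ha z).2
  rw [h] at this
  exact hz (by simpa using this.symm)

/-- Prepending a nonzero digit `d` in base `m + 1` adds the index `m * n + d`. -/
lemma decomp_add_digit (hm : 1 ≤ m) (ha : IsMGonalSeq m a) {n z d : ℕ}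
    (hz : z < 2 * (m + 1) ^ n) (hd : 1 ≤ d) (hdm : d ≤ m) :
    decomp m a (z + d * (2 * (m + 1) ^ n)) = insert (m * n + d) (decomp m a z) := by
  rw [← ha.apply_mul_add_one hm n] at hz ⊢
  have hsub := decomp_subset_range ha hz
  have hD := isDecomp_decomp ha z
  refine decomp_eq hm ha ⟨hD.1.insert hm (by rwa [binStart_mul_add n hd hdm]), ?_⟩
  have hni : m * n + d ∉ decomp m a z := fun h => by
    have := Finset.mem_range.1 (hsub h)
    omega
  rw [Finset.sum_insert hni, hD.2]
  obtain ⟨e, rfl⟩ : ∃ e, d = e + 1 := ⟨d - 1, by omega⟩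
  rw [ha.apply_mul_add hm n e (by omega)]
  ring

/-! ### Gaps of a decomposition -/

lemma consecutive_singleton (j : ℕ) : consecutive {j} = ∅ := by
  ext ⟨x, y⟩
  simp only [consecutive, Finset.mem_filter, Finset.mem_product, Finset.mem_singleton,
    Finset.notMem_empty, iff_false]
  omega

lemma consecutive_insert {S : Finset ℕ} {j : ℕ} (hS : S.Nonempty) (h : ∀ i ∈ S, i < j) :
    consecutive (insert j S) = insert (S.max' hS, j) (consecutive S) := by
  have hmax := S.max'_mem hS
  have hle : ∀ i ∈ S, i ≤ S.max' hS := fun i hi => S.le_max' i hi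
  generalize S.max' hS = M at hmax hle ⊢
  ext ⟨x, y⟩
  simp only [consecutive, Finset.mem_filter, Finset.mem_product, Finset.mem_insert, Prod.mk.injEq]
  constructor
  · rintro ⟨⟨rfl | hx, rfl | hy⟩, hlt, hno⟩
    · omega
    · have := h y hy
      omega
    · have h1 := hno M (Or.inr hmax)
      have h2 := h M hmax
      have h3 := hle x hx
      left
      omega
    · exact Or.inr ⟨⟨hx, hy⟩, hlt, fun k hk => hno k (Or.inr hk)⟩
  · rintro (⟨rfl, rfl⟩ | ⟨⟨hx, hy⟩, hlt, hno⟩)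
    · refine ⟨⟨Or.inr hmax, Or.inl rfl⟩, h _ hmax, ?_⟩
      rintro k (rfl | hk)
      · omega
      · have := hle k hk
        omega
    · refine ⟨⟨Or.inr hx, Or.inr hy⟩, hlt, ?_⟩
      rintro k (rfl | hk)
      · have := h y hy
        omega
      · exact hno k hk

lemma notMem_consecutive {S : Finset ℕ} {i j : ℕ} (h : j ∉ S) : (i, j) ∉ consecutive S := by
  simp [consecutive, h]

lemma card_consecutive (S : Finset ℕ) : (consecutive S).card = S.card - 1 := by
  induction S using Finset.induction_on_max with
  | empty => rfl
  | insert j S h ih =>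
    have hj : j ∉ S := fun hj => lt_irrefl j (h j hj)
    rcases S.eq_empty_or_nonempty with rfl | hS
    · simp [consecutive_singleton]
    · rw [consecutive_insert hS h, Finset.card_insert_of_notMem (notMem_consecutive hj), ih,
        Finset.card_insert_of_notMem hj]
      have := hS.card_pos
      omega

/-- The number of gaps of length `g` in the decomposition of `z`. -/
noncomputable def gapCount (m : ℕ) (a : ℕ → ℕ) (g z : ℕ) : ℕ :=
  ((consecutive (decomp m a z)).filter fun p => p.2 = p.1 + g).card

/-- The largest index in the decomposition of `z` (and `0` for `z = 0`). -/
noncomputable def lastIndex (m : ℕ) (a : ℕ → ℕ) (z : ℕ) : ℕ := (decomp m a z).sup id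

lemma lastIndex_eq_max' {z : ℕ} (h : (decomp m a z).Nonempty) :
    lastIndex m a z = (decomp m a z).max' h := by
  rw [lastIndex, Finset.max'_eq_sup', Finset.sup'_eq_sup]

lemma mem_decomp_lt (hm : 1 ≤ m) (ha : IsMGonalSeq m a) {n z i : ℕ}
    (hz : z < 2 * (m + 1) ^ n) (hi : i ∈ decomp m a z) : i < m * n + 1 := by
  rw [← ha.apply_mul_add_one hm n] at hz
  exact Finset.mem_range.1 (decomp_subset_range ha hz hi)

lemma lastIndex_add_digit (hm : 1 ≤ m) (ha : IsMGonalSeq m a) {n z d : ℕ}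
    (hz : z < 2 * (m + 1) ^ n) (hd : d < m) :
    lastIndex m a (z + (d + 1) * (2 * (m + 1) ^ n)) = m * n + (d + 1) := by
  rw [lastIndex, decomp_add_digit hm ha hz (by omega) (by omega), Finset.sup_insert]
  refine sup_eq_left.2 (Finset.sup_le fun i hi => ?_)
  have := mem_decomp_lt hm ha hz hi
  simp only [id]
  omega

lemma numSummands_zero (hm : 1 ≤ m) (ha : IsMGonalSeq m a) : numSummands m a 0 = 0 := by
  simp [numSummands, decomp_zero hm ha]

lemma gapCount_zero (hm : 1 ≤ m) (ha : IsMGonalSeq m a) (g : ℕ) : gapCount m a g 0 = 0 := by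
  simp [gapCount, decomp_zero hm ha, consecutive]

lemma numSummands_add_digit (hm : 1 ≤ m) (ha : IsMGonalSeq m a) {n z d : ℕ}
    (hz : z < 2 * (m + 1) ^ n) (hd : d < m) :
    numSummands m a (z + (d + 1) * (2 * (m + 1) ^ n)) = numSummands m a z + 1 := by
  rw [numSummands, decomp_add_digit hm ha hz (by omega) (by omega), Finset.card_insert_of_notMem,
    numSummands]
  intro h
  have := mem_decomp_lt hm ha hz h
  omega

/-- A new nonzero leading digit creates one gap, unless it is the first summand. -/
lemma gapCount_add_digit (hm : 1 ≤ m) (ha : IsMGonalSeq m a) (g : ℕ) {n z d : ℕ}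
    (hz : z < 2 * (m + 1) ^ n) (hd : d < m) :
    gapCount m a g (z + (d + 1) * (2 * (m + 1) ^ n)) =
      gapCount m a g z +
        if z ≠ 0 ∧ m * n + (d + 1) = lastIndex m a z + g then 1 else 0 := by
  rw [gapCount, decomp_add_digit hm ha hz (by omega) (by omega)]
  have hlt : ∀ i ∈ decomp m a z, i < m * n + (d + 1) := fun i hi => by
    have := mem_decomp_lt hm ha hz hi
    omega
  rcases eq_or_ne z 0 with rfl | h0
  · simp [decomp_zero hm ha, consecutive_singleton, gapCount_zero hm ha]
  · have hne := decomp_nonempty (m := m) ha h0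
    rw [consecutive_insert hne hlt, Finset.filter_insert, lastIndex_eq_max' hne]
    have hno : m * n + (d + 1) ∉ decomp m a z := fun h => lt_irrefl _ (hlt _ h)
    split_ifs with h1 h2 h2
    · rw [Finset.card_insert_of_notMem]
      · rfl
      · exact fun h => notMem_consecutive hno (Finset.mem_filter.1 h).1
    · exact absurd ⟨h0, h1⟩ h2
    · exact absurd h2.2 h1
    · rfl

/-! ### Martingales along the digits -/

/-- A family `M n z` of real numbers that is a martingale with increments bounded by `c` when the
digits of `z` are revealed one after another: for `z < 2 * (m + 1) ^ n`, the average of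
`M (n + 1)` over the `m + 1` ways of adding a leading digit to `z` is `M n z`. -/
def IsDigitMartingale (m : ℕ) (c : ℝ) (M : ℕ → ℕ → ℝ) : Prop :=
  ∀ n z, z < 2 * (m + 1) ^ n →
    (∑ d ∈ Finset.range (m + 1), M (n + 1) (z + d * (2 * (m + 1) ^ n)) = (m + 1) * M n z) ∧
    ∀ d ≤ m, |M (n + 1) (z + d * (2 * (m + 1) ^ n)) - M n z| ≤ c

lemma IsDigitMartingale.neg {c : ℝ} {M : ℕ → ℕ → ℝ} (h : IsDigitMartingale m c M) :
    IsDigitMartingale m c fun n z => -M n z := by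
  intro n z hz
  obtain ⟨h1, h2⟩ := h n z hz
  refine ⟨by rw [Finset.sum_neg_distrib, h1]; ring, fun d hd => ?_⟩
  rw [← abs_neg]
  convert h2 d hd using 2
  ring

/-- The expected number of new summands per digit. -/
noncomputable def summandRate (m : ℕ) : ℝ := m / (m + 1)

lemma summand_martingale (hm : 1 ≤ m) (ha : IsMGonalSeq m a) :
    IsDigitMartingale m 1 fun n z => (numSummands m a z : ℝ) - n * summandRate m := by
  intro n z hz
  have hr : (m + 1 : ℝ) * summandRate m = m := by
    rw [summandRate]
    field_simp
  have hr0 : 0 ≤ summandRate m := by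
    rw [summandRate]
    positivity
  have hr1 : summandRate m ≤ 1 := by
    rw [summandRate, div_le_one (by positivity)]
    linarith
  constructor
  · beta_reduce
    rw [Finset.sum_range_succ', Finset.sum_congr rfl fun d hd => by
      rw [numSummands_add_digit hm ha hz (Finset.mem_range.1 hd)]]
    simp only [zero_mul, add_zero, Finset.sum_const, Finset.card_range, nsmul_eq_mul]
    push_cast
    linear_combination -hr
  · intro d hd
    rcases d with _ | d
    · simp only [zero_mul, add_zero]
      push_cast
      rw [abs_le]
      constructor <;> linarith
    · beta_reduce
      rw [numSummands_add_digit hm ha hz hd]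
      push_cast
      rw [abs_le]
      constructor <;> linarith

/-- The probability that the first nonzero digit in an infinite string of uniformly distributed
digits sits at the index `r ≥ 1` when the indices are numbered from `1` and grouped into bins of
size `m`; the value at `r = 0` is set to `0`. -/
noncomputable def firstProb (m r : ℕ) : ℝ := if r = 0 then 0 else ((m + 1 : ℝ) ^ bin m r)⁻¹

lemma firstProb_nonneg (m r : ℕ) : 0 ≤ firstProb m r := by
  unfold firstProb
  split_ifs <;> positivity

lemma firstProb_le_one (m r : ℕ) : firstProb m r ≤ 1 := by
  unfold firstProb
  split_ifs
  · exact zero_le_one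
  · exact inv_le_one_of_one_le₀ (one_le_pow₀ (by linarith [m.cast_nonneg (α := ℝ)]))

/-- Conditioning on the first digit. -/
lemma firstProb_step (hm : 1 ≤ m) (r : ℕ) :
    (m + 1) * firstProb m r = firstProb m (r - m) + if 1 ≤ r ∧ r ≤ m then 1 else 0 := by
  have hB : (m + 1 : ℝ) ≠ 0 := by positivity
  rcases Nat.eq_zero_or_pos r with rfl | hr
  · simp [firstProb]
  rcases le_or_gt r m with h | h
  · have hb : bin m r = 1 := by
      rw [bin, if_neg (by omega), Nat.div_eq_of_lt (by omega)]
    rw [firstProb, if_neg (by omega), hb, show r - m = 0 by omega, if_pos ⟨hr, h⟩, firstProb,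
      if_pos rfl]
    field_simp
    ring
  · have hb : bin m r = bin m (r - m) + 1 := by
      rw [bin, bin, if_neg (by omega), if_neg (by omega),
        show r - 1 = (r - m - 1) + m by omega, Nat.add_div_right _ hm]
    rw [firstProb, if_neg (by omega), hb, firstProb, if_neg (by omega), if_neg (by omega), pow_succ]
    field_simp
    ring

/-- The expected number of new gaps of length `g` per digit. -/
noncomputable def gapRate (m g : ℕ) : ℝ :=
  (∑ d ∈ Finset.range m, firstProb m (d + 1 + g - m)) / (m + 1)

lemma gapRate_nonneg (m g : ℕ) : 0 ≤ gapRate m g :=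
  div_nonneg (Finset.sum_nonneg fun _ _ => firstProb_nonneg _ _) (by positivity)

lemma gapRate_le_one (m g : ℕ) : gapRate m g ≤ 1 := by
  rw [gapRate, div_le_one (by positivity)]
  calc _ ≤ ∑ d ∈ Finset.range m, (1 : ℝ) := Finset.sum_le_sum fun _ _ => firstProb_le_one _ _
    _ ≤ _ := by simp

/-- The conditional probability, given the digits of `z < 2 * (m + 1) ^ n`, that the gap following
the last summand of `z` will have length `g`. -/
noncomputable def pendingGap (m : ℕ) (a : ℕ → ℕ) (g n z : ℕ) : ℝ :=
  if z = 0 then 0 else firstProb m (lastIndex m a z + g - m * n)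

lemma pendingGap_mem (m : ℕ) (a : ℕ → ℕ) (g n z : ℕ) :
    0 ≤ pendingGap m a g n z ∧ pendingGap m a g n z ≤ 1 := by
  unfold pendingGap
  split_ifs
  · simp
  · exact ⟨firstProb_nonneg _ _, firstProb_le_one _ _⟩

lemma pendingGap_add_digit (hm : 1 ≤ m) (ha : IsMGonalSeq m a) (g : ℕ) {n z d : ℕ}
    (hz : z < 2 * (m + 1) ^ n) (hd : d < m) :
    pendingGap m a g (n + 1) (z + (d + 1) * (2 * (m + 1) ^ n)) =
      firstProb m (d + 1 + g - m) := by
  have h0 : z + (d + 1) * (2 * (m + 1) ^ n) ≠ 0 := by positivity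
  rw [pendingGap, if_neg h0, lastIndex_add_digit hm ha hz hd]
  congr 1
  rw [mul_add, mul_one]
  omega

lemma pendingGap_step (hm : 1 ≤ m) (a : ℕ → ℕ) (g n z : ℕ) :
    (m + 1) * pendingGap m a g n z = pendingGap m a g (n + 1) z +
      ∑ d ∈ Finset.range m,
        if z ≠ 0 ∧ m * n + (d + 1) = lastIndex m a z + g then (1 : ℝ) else 0 := by
  rcases eq_or_ne z 0 with rfl | h0
  · simp [pendingGap]
  rw [pendingGap, pendingGap, if_neg h0, if_neg h0, firstProb_step hm,
    show lastIndex m a z + g - m * (n + 1) = lastIndex m a z + g - m * n - m by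
      rw [mul_add, mul_one]; omega]
  congr 1
  simp only [ne_eq, h0, not_false_eq_true, true_and]
  rw [Finset.sum_congr rfl fun d _ => if_congr (show _ ↔ 1 ≤ lastIndex m a z + g - m * n ∧
    lastIndex m a z + g - m * n - 1 = d by omega) rfl rfl]
  split_ifs with h
  · simp only [h.1, true_and]
    rw [Finset.sum_ite_eq, if_pos (Finset.mem_range.2 (by omega))]
  · refine (Finset.sum_eq_zero fun d hd => if_neg ?_).symm
    have := Finset.mem_range.1 hd
    omega

/-- The number of gaps of length `g` becomes a martingale after subtracting its mean growth and
adding the conditional probability that the gap still open will have length `g`. -/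
lemma gap_martingale (hm : 1 ≤ m) (ha : IsMGonalSeq m a) (g : ℕ) :
    IsDigitMartingale m 3 fun n z =>
      (gapCount m a g z : ℝ) + pendingGap m a g n z - n * gapRate m g := by
  intro n z hz
  have hr : (m + 1 : ℝ) * gapRate m g = ∑ d ∈ Finset.range m, firstProb m (d + 1 + g - m) := by
    rw [gapRate]
    field_simp
  have hr0 := gapRate_nonneg m g
  have hr1 := gapRate_le_one m g
  constructor
  · beta_reduce
    rw [Finset.sum_range_succ', Finset.sum_congr rfl fun d hd => by
      rw [gapCount_add_digit hm ha g hz (Finset.mem_range.1 hd),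
        pendingGap_add_digit hm ha g hz (Finset.mem_range.1 hd)]]
    have hs := pendingGap_step hm a g n z
    simp only [zero_mul, add_zero, Finset.sum_add_distrib, Finset.sum_sub_distrib,
      Finset.sum_const, Finset.card_range, nsmul_eq_mul, Nat.cast_add, Nat.cast_ite, Nat.cast_one,
      Nat.cast_zero]
    linear_combination -hr - hs
  · intro d hd
    have h1 := pendingGap_mem m a g n z
    have h2 := pendingGap_mem m a g (n + 1) (z + d * (2 * (m + 1) ^ n))
    have h3 : (gapCount m a g z : ℝ) ≤ gapCount m a g (z + d * (2 * (m + 1) ^ n)) ∧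
        (gapCount m a g (z + d * (2 * (m + 1) ^ n)) : ℝ) ≤ gapCount m a g z + 1 := by
      rcases d with _ | d
      · simp
      · rw [gapCount_add_digit hm ha g hz hd]
        split_ifs <;> simp
    simp only
    push_cast
    rw [abs_le]
    constructor <;> linarith

/-! ### Concentration for martingales along the digits -/

lemma sum_range_mul_eq_sum_digits (f : ℕ → ℝ) (N k : ℕ) :
    ∑ z ∈ Finset.range (k * N), f z =
      ∑ z ∈ Finset.range N, ∑ d ∈ Finset.range k, f (z + d * N) := by
  induction k with
  | zero => simp
  | succ k ih =>
    rw [add_mul, one_mul, Finset.sum_range_add, ih]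
    simp only [Finset.sum_range_succ, Finset.sum_add_distrib, add_comm]

lemma sum_range_pow_succ (m : ℕ) (f : ℕ → ℝ) (n : ℕ) :
    ∑ z ∈ Finset.range (2 * (m + 1) ^ (n + 1)), f z =
      ∑ z ∈ Finset.range (2 * (m + 1) ^ n), ∑ d ∈ Finset.range (m + 1),
        f (z + d * (2 * (m + 1) ^ n)) := by
  rw [← sum_range_mul_eq_sum_digits]
  congr 2
  ring

lemma IsDigitMartingale.sum_eq {c : ℝ} {M : ℕ → ℕ → ℝ} (h : IsDigitMartingale m c M) (n : ℕ) :
    ∑ z ∈ Finset.range (2 * (m + 1) ^ n), M n z =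
      (m + 1) ^ n * ∑ z ∈ Finset.range 2, M 0 z := by
  induction n with
  | zero => simp
  | succ n ih =>
    rw [sum_range_pow_succ, Finset.sum_congr rfl fun z hz => (h n z (Finset.mem_range.1 hz)).1,
      ← Finset.mul_sum, ih]
    ring

lemma IsDigitMartingale.sum_exp_le {c t : ℝ} {M : ℕ → ℕ → ℝ} (h : IsDigitMartingale m c M)
    (ht : 0 ≤ t) (htc : t * c ≤ 1) (n : ℕ) :
    ∑ z ∈ Finset.range (2 * (m + 1) ^ n), Real.exp (t * M n z) ≤
      ((m + 1) * Real.exp ((t * c) ^ 2)) ^ n * ∑ z ∈ Finset.range 2, Real.exp (t * M 0 z) := by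
  induction n with
  | zero => simp
  | succ n ih =>
    rw [sum_range_pow_succ]
    have key : ∀ z ∈ Finset.range (2 * (m + 1) ^ n),
        ∑ d ∈ Finset.range (m + 1), Real.exp (t * M (n + 1) (z + d * (2 * (m + 1) ^ n))) ≤
          ((m + 1) * Real.exp ((t * c) ^ 2)) * Real.exp (t * M n z) := by
      intro z hz
      obtain ⟨h1, h2⟩ := h n z (Finset.mem_range.1 hz)
      have h3 : ∀ d ∈ Finset.range (m + 1),
          Real.exp (t * M (n + 1) (z + d * (2 * (m + 1) ^ n))) ≤
            Real.exp (t * M n z) * (1 + (t * c) ^ 2 +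
              t * (M (n + 1) (z + d * (2 * (m + 1) ^ n)) - M n z)) := by
        intro d hd
        have hd' := h2 d (Nat.lt_succ_iff.1 (Finset.mem_range.1 hd))
        set D := M (n + 1) (z + d * (2 * (m + 1) ^ n)) - M n z with hD
        rw [show t * M (n + 1) (z + d * (2 * (m + 1) ^ n)) = t * M n z + t * D by rw [hD]; ring,
          Real.exp_add]
        refine mul_le_mul_of_nonneg_left ?_ (Real.exp_nonneg _)
        have h4 : |t * D| ≤ t * c := by
          rw [abs_mul, abs_of_nonneg ht]
          exact mul_le_mul_of_nonneg_left hd' ht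
        have h5 := (abs_le.1 (Real.abs_exp_sub_one_sub_id_le (h4.trans htc))).2
        have h6 : (t * D) ^ 2 ≤ (t * c) ^ 2 := by
          rw [← sq_abs (t * D)]
          exact pow_le_pow_left₀ (abs_nonneg _) h4 2
        linarith
      refine (Finset.sum_le_sum h3).trans ?_
      rw [← Finset.mul_sum, Finset.sum_add_distrib, ← Finset.mul_sum, Finset.sum_sub_distrib, h1]
      simp only [Finset.sum_const, Finset.card_range, nsmul_eq_mul]
      push_cast
      have h7 : (t * c) ^ 2 + 1 ≤ Real.exp ((t * c) ^ 2) := Real.add_one_le_exp _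
      calc _ = Real.exp (t * M n z) * ((m + 1) * ((t * c) ^ 2 + 1)) := by ring
        _ ≤ Real.exp (t * M n z) * ((m + 1) * Real.exp ((t * c) ^ 2)) := by gcongr
        _ = _ := by ring
    refine (Finset.sum_le_sum key).trans ?_
    rw [← Finset.mul_sum, pow_succ' ((m + 1 : ℝ) * Real.exp ((t * c) ^ 2)),
      mul_assoc ((m + 1 : ℝ) * Real.exp ((t * c) ^ 2))]
    exact mul_le_mul_of_nonneg_left ih (by positivity)

/-- Chernoff's bound: linear deviations have exponentially small probability. -/
lemma IsDigitMartingale.card_le {c ε : ℝ} {M : ℕ → ℕ → ℝ} (h : IsDigitMartingale m c M)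
    (hc : 0 < c) (hε : 0 < ε) :
    ∃ C ρ : ℝ, 0 ≤ C ∧ 0 ≤ ρ ∧ ρ < 1 ∧ ∀ n : ℕ,
      (((Finset.range (2 * (m + 1) ^ n)).filter fun z => ε * n ≤ M n z).card : ℝ) ≤
        C * ρ ^ n * (2 * (m + 1) ^ n) := by
  -- `t` is small enough for the quadratic term `(t * c) ^ 2` to be at most half of `t * ε`
  set t := min (1 / c) (ε / (2 * c ^ 2)) with ht
  have ht0 : 0 < t := lt_min (by positivity) (by positivity)
  have htc : t * c ≤ 1 := by
    rw [← le_div_iff₀ hc]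
    exact min_le_left _ _
  have htε : t * (2 * c ^ 2) ≤ ε := by
    rw [← le_div_iff₀ (by positivity)]
    exact min_le_right _ _
  refine ⟨∑ z ∈ Finset.range 2, Real.exp (t * M 0 z), Real.exp ((t * c) ^ 2 - t * ε),
    Finset.sum_nonneg fun _ _ => Real.exp_nonneg _, Real.exp_nonneg _, ?_, fun n => ?_⟩
  · rw [Real.exp_lt_one_iff]
    nlinarith
  · have h1 := h.sum_exp_le ht0.le htc n
    set F := (Finset.range (2 * (m + 1) ^ n)).filter fun z => ε * n ≤ M n z with hF
    have h2 : (F.card : ℝ) * Real.exp (t * ε * n) ≤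
        ∑ z ∈ Finset.range (2 * (m + 1) ^ n), Real.exp (t * M n z) := by
      calc (F.card : ℝ) * Real.exp (t * ε * n) = ∑ z ∈ F, Real.exp (t * ε * n) := by simp
        _ ≤ ∑ z ∈ F, Real.exp (t * M n z) := by
          refine Finset.sum_le_sum fun z hz => Real.exp_le_exp.2 ?_
          rw [mul_assoc]
          exact mul_le_mul_of_nonneg_left (Finset.mem_filter.1 hz).2 ht0.le
        _ ≤ _ := Finset.sum_le_sum_of_subset_of_nonneg (Finset.filter_subset _ _)
          fun _ _ _ => Real.exp_nonneg _
    have h3 : Real.exp ((t * c) ^ 2 - t * ε) ^ n * Real.exp (t * ε * n) =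
        Real.exp ((t * c) ^ 2) ^ n := by
      rw [← Real.exp_nat_mul, ← Real.exp_nat_mul, ← Real.exp_add]
      congr 1
      ring
    have hC : 0 ≤ ∑ z ∈ Finset.range 2, Real.exp (t * M 0 z) :=
      Finset.sum_nonneg fun _ _ => Real.exp_nonneg _
    refine le_of_mul_le_mul_right ?_ (Real.exp_pos (t * ε * n))
    refine (h2.trans h1).trans ?_
    rw [mul_pow, ← h3]
    set C := ∑ z ∈ Finset.range 2, Real.exp (t * M 0 z)
    have h4 : 0 ≤ (m + 1 : ℝ) ^ n * (Real.exp ((t * c) ^ 2 - t * ε) ^ n *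
      Real.exp (t * ε * n)) * C := by positivity
    linarith

variable {Ω : Type*} [MeasurableSpace Ω] {μ : Measure Ω}

lemma measure_preimage_uniformOn {N : ℕ} {Z : Ω → ℕ}
    (hZ : HasLaw Z (uniformOn (Set.Ico 0 N)) μ) (p : ℕ → Prop) [DecidablePred p] :
    μ {ω | p (Z ω)} = (((Finset.range N).filter p).card : ENNReal) / N := by
  have h1 : μ {ω | p (Z ω)} = μ.map Z {z | p z} := by
    rw [Measure.map_apply_of_aemeasurable hZ.aemeasurable .of_discrete]
    rfl
  have h2 : (Set.Ico 0 N : Set ℕ) = (Finset.range N : Finset ℕ) := by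
    ext
    simp
  have h3 : (Finset.range N : Set ℕ) ∩ {z | p z} = ((Finset.range N).filter p : Finset ℕ) := by
    ext
    simp
  rw [h1, hZ.map_eq, h2, ← uniformOn_inter_self (Finset.finite_toSet _), h3,
    uniformOn_apply_finset, Finset.card_range, Finset.inter_eq_right.2 (Finset.filter_subset _ _)]

/-- The Borel–Cantelli lemma; the joint distribution of the `Z n` plays no role because the
probabilities are summable. -/
lemma IsDigitMartingale.ae_eventually_lt {c ε : ℝ} {M : ℕ → ℕ → ℝ}
    (h : IsDigitMartingale m c M) (hc : 0 < c) (hε : 0 < ε) {Z : ℕ → Ω → ℕ}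
    (hZ : ∀ n, 0 < n → HasLaw (Z n) (uniformOn (Set.Ico 0 (2 * (m + 1) ^ n))) μ) :
    ∀ᵐ ω ∂μ, ∀ᶠ n : ℕ in atTop, M n (Z n ω) < ε * n := by
  classical
  obtain ⟨C, ρ, hC, hρ0, hρ1, hcard⟩ := h.card_le hc hε
  have hb : ∀ n : ℕ, μ {ω | ε * ((n + 1 : ℕ) : ℝ) ≤ M (n + 1) (Z (n + 1) ω)} ≤
      ENNReal.ofReal (C * ρ ^ (n + 1)) := by
    intro n
    rw [measure_preimage_uniformOn (hZ (n + 1) n.succ_pos)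
      (fun z => ε * ((n + 1 : ℕ) : ℝ) ≤ M (n + 1) z)]
    refine ENNReal.div_le_of_le_mul ?_
    rw [← ENNReal.ofReal_natCast, ← ENNReal.ofReal_natCast,
      ← ENNReal.ofReal_mul (by positivity)]
    refine ENNReal.ofReal_le_ofReal ((hcard (n + 1)).trans_eq ?_)
    push_cast
    ring
  have hsum : ∑' n : ℕ, μ {ω | ε * ((n + 1 : ℕ) : ℝ) ≤ M (n + 1) (Z (n + 1) ω)} ≠ ⊤ := by
    refine ne_top_of_le_ne_top ?_ (ENNReal.tsum_le_tsum hb)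
    refine Summable.tsum_ofReal_ne_top ?_
    exact ((summable_nat_add_iff 1).2 (summable_geometric_of_lt_one hρ0 hρ1)).mul_left C
  filter_upwards [ae_eventually_notMem hsum] with ω hω
  rw [← map_add_atTop_eq_nat 1, eventually_map]
  filter_upwards [hω] with n hn
  simpa using hn

/-- The strong law of large numbers for martingales along the digits. -/
lemma IsDigitMartingale.ae_tendsto {c : ℝ} {M : ℕ → ℕ → ℝ}
    (h : IsDigitMartingale m c M) (hc : 0 < c) {Z : ℕ → Ω → ℕ}
    (hZ : ∀ n, 0 < n → HasLaw (Z n) (uniformOn (Set.Ico 0 (2 * (m + 1) ^ n))) μ) :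
    ∀ᵐ ω ∂μ, Tendsto (fun n : ℕ => M n (Z n ω) / n) atTop (𝓝 0) := by
  have h1 : ∀ᵐ ω ∂μ, ∀ k : ℕ, ∀ᶠ n : ℕ in atTop, M n (Z n ω) < 1 / ((k : ℝ) + 1) * n :=
    ae_all_iff.2 fun k => h.ae_eventually_lt hc (by positivity) hZ
  have h2 : ∀ᵐ ω ∂μ, ∀ k : ℕ, ∀ᶠ n : ℕ in atTop, -M n (Z n ω) < 1 / ((k : ℝ) + 1) * n :=
    ae_all_iff.2 fun k => h.neg.ae_eventually_lt hc (by positivity) hZ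
  filter_upwards [h1, h2] with ω hω1 hω2
  rw [Metric.tendsto_nhds]
  intro ε hε
  obtain ⟨k, hk⟩ := exists_nat_one_div_lt hε
  filter_upwards [hω1 k, hω2 k, eventually_gt_atTop 0] with n hn1 hn2 hn
  have hn' : (0 : ℝ) < n := Nat.cast_pos.2 hn
  rw [dist_zero_right, Real.norm_eq_abs, abs_div, abs_of_pos hn', div_lt_iff₀ hn', abs_lt]
  have := mul_lt_mul_of_pos_right hk hn'
  constructor <;> linarith

/-! ### Growth rates -/

/-- A quantity that grows like `n * w` up to a digit martingale and a bounded error has mean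
`n * w + O(1)`. -/
lemma IsDigitMartingale.tendsto_average {c w : ℝ} {M : ℕ → ℕ → ℝ} {X : ℕ → ℝ}
    (h : IsDigitMartingale m c M) (hX : ∀ n z, |X z - n * w - M n z| ≤ 1) :
    Tendsto (fun n : ℕ => (∑ z ∈ Finset.range (2 * (m + 1) ^ n), X z) /
      ((2 * (m + 1) ^ n : ℕ) * n)) atTop (𝓝 w) := by
  set C := ∑ z ∈ Finset.range 2, M 0 z with hC
  rw [tendsto_iff_dist_tendsto_zero]
  refine squeeze_zero' (Eventually.of_forall fun _ => dist_nonneg) ?_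
    (tendsto_const_div_atTop_nhds_zero_nat (|C| / 2 + 1))
  filter_upwards [eventually_gt_atTop 0] with n hn
  have hn' : (0 : ℝ) < n := Nat.cast_pos.2 hn
  set N := 2 * (m + 1) ^ n with hN
  have hNpos : (0 : ℝ) < (N : ℝ) := by positivity
  have h1 : |∑ z ∈ Finset.range N, (X z - n * w - M n z)| ≤ N := by
    refine (Finset.abs_sum_le_sum_abs _ _).trans ?_
    refine (Finset.sum_le_sum fun z _ => hX n z).trans ?_
    simp
  have h2 : |∑ z ∈ Finset.range N, M n z| = N * (|C| / 2) := by
    rw [h.sum_eq n, abs_mul, abs_of_pos (by positivity), hN]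
    push_cast
    ring
  simp only [Finset.sum_sub_distrib, Finset.sum_const, Finset.card_range, nsmul_eq_mul] at h1
  rw [Real.dist_eq]
  have h3 : (∑ z ∈ Finset.range N, X z) / (N * n) - w =
      ((∑ z ∈ Finset.range N, X z - N * (n * w) - ∑ z ∈ Finset.range N, M n z) +
        ∑ z ∈ Finset.range N, M n z) / (N * n) := by
    field_simp
    ring
  rw [h3, abs_div, abs_of_pos (mul_pos hNpos hn'), div_le_div_iff₀ (by positivity) hn']
  have h4 := (abs_add_le (∑ z ∈ Finset.range N, X z - N * (n * w) -
    ∑ z ∈ Finset.range N, M n z) (∑ z ∈ Finset.range N, M n z)).trans (add_le_add h1 h2.le)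
  calc _ ≤ (N + N * (|C| / 2)) * n := by gcongr
    _ = _ := by ring

/-- Almost surely, such a quantity grows at its mean rate. -/
lemma IsDigitMartingale.ae_tendsto_rate {c w : ℝ} {M : ℕ → ℕ → ℝ} {X : ℕ → ℝ}
    (h : IsDigitMartingale m c M) (hc : 0 < c) (hX : ∀ n z, |X z - n * w - M n z| ≤ 1)
    {Ω : Type*} [MeasurableSpace Ω] {μ : Measure Ω} {Z : ℕ → Ω → ℕ}
    (hZ : ∀ n, 0 < n → HasLaw (Z n) (uniformOn (Set.Ico 0 (2 * (m + 1) ^ n))) μ) :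
    ∀ᵐ ω ∂μ, Tendsto (fun n : ℕ => X (Z n ω) / n) atTop (𝓝 w) := by
  filter_upwards [h.ae_tendsto hc hZ] with ω hω
  have h1 : Tendsto (fun n : ℕ => (X (Z n ω) - n * w - M n (Z n ω)) / n) atTop (𝓝 0) := by
    rw [tendsto_zero_iff_norm_tendsto_zero]
    refine squeeze_zero (fun _ => norm_nonneg _) (fun n => ?_)
      (tendsto_const_div_atTop_nhds_zero_nat (1 : ℝ))
    rw [norm_div, Real.norm_eq_abs, Real.norm_natCast]
    exact div_le_div_of_nonneg_right (hX n _) n.cast_nonneg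
  have h2 := (h1.add hω).add_const w
  rw [add_zero, zero_add] at h2
  refine h2.congr' ?_
  filter_upwards [eventually_gt_atTop 0] with n hn
  have hn' : (n : ℝ) ≠ 0 := Nat.cast_ne_zero.2 hn.ne'
  field_simp
  ring

lemma summand_error (m : ℕ) (a : ℕ → ℕ) (n z : ℕ) :
    |((numSummands m a z - 1 : ℕ) : ℝ) - n * summandRate m -
      ((numSummands m a z : ℝ) - n * summandRate m)| ≤ 1 := by
  rcases Nat.eq_zero_or_pos (numSummands m a z) with h | h
  · simp [h]
  · rw [Nat.cast_sub h]
    simp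

lemma gap_error (m : ℕ) (a : ℕ → ℕ) (g n z : ℕ) :
    |(gapCount m a g z : ℝ) - n * gapRate m g -
      ((gapCount m a g z : ℝ) + pendingGap m a g n z - n * gapRate m g)| ≤ 1 := by
  have := pendingGap_mem m a g n z
  rw [abs_le]
  constructor <;> linarith

/-! ### The limiting gap measure -/

lemma sum_firstProb (hm : 1 ≤ m) (n : ℕ) :
    ∑ r ∈ Finset.range (m * n + 1), firstProb m r = 1 - ((m + 1 : ℝ)⁻¹) ^ n := by
  induction n with
  | zero => simp [firstProb]
  | succ n ih =>
    have hB : (m + 1 : ℝ) ≠ 0 := by positivity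
    have hterm : ∀ x ∈ Finset.range m, firstProb m (m * n + 1 + x) = ((m + 1 : ℝ)⁻¹) ^ (n + 1) := by
      intro x hx
      have hx := Finset.mem_range.1 hx
      rw [firstProb, if_neg (by omega), bin, if_neg (by omega),
        show m * n + 1 + x - 1 = x + m * n by omega, Nat.add_mul_div_left _ _ (by omega),
        Nat.div_eq_of_lt hx, zero_add, inv_pow]
    rw [show m * (n + 1) + 1 = m * n + 1 + m by ring, Finset.sum_range_add, ih,
      Finset.sum_congr rfl hterm]
    simp only [Finset.sum_const, Finset.card_range, nsmul_eq_mul, pow_succ]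
    field_simp
    ring

lemma hasSum_firstProb (hm : 1 ≤ m) : HasSum (firstProb m) 1 := by
  rw [hasSum_iff_tendsto_nat_of_nonneg (firstProb_nonneg m)]
  have hmono : Monotone fun n => ∑ i ∈ Finset.range n, firstProb m i :=
    monotone_nat_of_le_succ fun n => by
      rw [Finset.sum_range_succ]
      exact le_add_of_nonneg_right (firstProb_nonneg m n)
  have hφ : Tendsto (fun n => m * n + 1) atTop atTop :=
    tendsto_atTop_mono (fun n => (Nat.le_mul_of_pos_left n hm).trans (Nat.le_succ _)) tendsto_id
  rw [tendsto_iff_tendsto_subseq_of_monotone hmono hφ]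
  have hm' : (1 : ℝ) ≤ m := by exact_mod_cast hm
  have hlim : Tendsto (fun n : ℕ => 1 - ((m + 1 : ℝ)⁻¹) ^ n) atTop (𝓝 (1 - 0)) :=
    tendsto_const_nhds.sub (tendsto_pow_atTop_nhds_zero_of_lt_one (by positivity)
      (inv_lt_one_of_one_lt₀ (by linarith)))
  rw [sub_zero] at hlim
  exact hlim.congr fun n => (sum_firstProb hm n).symm

lemma summandRate_pos (hm : 1 ≤ m) : 0 < summandRate m := by
  have : (0 : ℝ) < m := by exact_mod_cast hm
  rw [summandRate]
  positivity

/-- The gap rates add up to the summand rate: every summand is followed by exactly one gap. -/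
lemma hasSum_gapRate (hm : 1 ≤ m) : HasSum (gapRate m) (summandRate m) := by
  have h : ∀ d ∈ Finset.range m, HasSum (fun g => firstProb m (d + 1 + g - m)) 1 := by
    intro d hd
    have hd := Finset.mem_range.1 hd
    have h0 : ∑ i ∈ Finset.range (m - (d + 1)), firstProb m (d + 1 + i - m) = 0 := by
      refine Finset.sum_eq_zero fun i hi => ?_
      have := Finset.mem_range.1 hi
      rw [show d + 1 + i - m = 0 by omega, firstProb, if_pos rfl]
    have h1 := (hasSum_nat_add_iff (f := fun g => firstProb m (d + 1 + g - m)) (g := 1)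
      (m - (d + 1))).1 (by
        simpa only [show ∀ n, d + 1 + (n + (m - (d + 1))) - m = n by omega] using
          hasSum_firstProb hm)
    rwa [h0, add_zero] at h1
  have h2 := (hasSum_sum h).div_const (m + 1 : ℝ)
  simp only [Finset.sum_const, Finset.card_range, nsmul_eq_mul, mul_one] at h2
  exact h2

/-- The limiting proportion of gaps of length `g`. -/
noncomputable def limitProb (m g : ℕ) : ℝ := gapRate m g / summandRate m

lemma limitProb_nonneg (hm : 1 ≤ m) (g : ℕ) : 0 ≤ limitProb m g :=
  div_nonneg (gapRate_nonneg m g) (summandRate_pos hm).le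

lemma hasSum_limitProb (hm : 1 ≤ m) : HasSum (limitProb m) 1 := by
  have := (hasSum_gapRate hm).div_const (summandRate m)
  rwa [div_self (summandRate_pos hm).ne'] at this

lemma exists_probabilityMeasure_of_hasSum {p : ℕ → ℝ} (hp : ∀ g, 0 ≤ p g) (hs : HasSum p 1) :
    ∃ ν : ProbabilityMeasure ℝ, ∀ g : ℕ, (ν {(g : ℝ)} : ℝ) = p g := by
  set κ : Measure ℝ := Measure.sum fun g : ℕ => ENNReal.ofReal (p g) • Measure.dirac (g : ℝ)
    with hκ
  have h1 : IsProbabilityMeasure κ := by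
    refine ⟨?_⟩
    rw [hκ, Measure.sum_apply _ .univ]
    simp only [Measure.smul_apply, measure_univ, smul_eq_mul, mul_one]
    rw [← ENNReal.ofReal_tsum_of_nonneg hp hs.summable, hs.tsum_eq, ENNReal.ofReal_one]
  refine ⟨⟨κ, h1⟩, fun g => ?_⟩
  have h2 : κ {(g : ℝ)} = ENNReal.ofReal (p g) := by
    rw [hκ, Measure.sum_apply _ (measurableSet_singleton _), tsum_eq_single g]
    · simp
    · intro k hk
      have : (k : ℝ) ≠ g := by exact_mod_cast hk
      simp [this]
  change ((κ {(g : ℝ)}).toNNReal : ℝ) = p g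
  rw [h2, ENNReal.coe_toNNReal_eq_toReal, ENNReal.toReal_ofReal (hp g)]

/-! ### Weak convergence from point masses -/

lemma abs_integral_sub_sum_le (μ : FiniteMeasure ℝ) (f : BoundedContinuousFunction ℝ ℝ) (G : ℕ) :
    |∫ x, f x ∂(μ : Measure ℝ) - ∑ g ∈ Finset.range G, f g * (μ {(g : ℝ)} : ℝ)| ≤
      ‖f‖ * ((μ.mass : ℝ) - ∑ g ∈ Finset.range G, (μ {(g : ℝ)} : ℝ)) := by
  set A : Finset ℝ := (Finset.range G).map Nat.castEmbedding with hA
  have hAm : MeasurableSet (A : Set ℝ) := A.measurableSet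
  have hf : Integrable f (μ : Measure ℝ) := f.integrable _
  have h1 : ∫ x in (A : Set ℝ), f x ∂(μ : Measure ℝ) =
      ∑ g ∈ Finset.range G, f g * (μ {(g : ℝ)} : ℝ) := by
    rw [setIntegral_finset _ hf.integrableOn, hA, Finset.sum_map]
    refine Finset.sum_congr rfl fun g _ => ?_
    rw [FiniteMeasure.measureReal_eq_coe_coeFn, smul_eq_mul, mul_comm]
    rfl
  have h2 : (μ : Measure ℝ).real (A : Set ℝ) = ∑ g ∈ Finset.range G, (μ {(g : ℝ)} : ℝ) := by
    rw [← sum_measureReal_singleton, hA, Finset.sum_map]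
    exact Finset.sum_congr rfl fun g _ => FiniteMeasure.measureReal_eq_coe_coeFn
  have h3 : (μ : Measure ℝ).real (A : Set ℝ)ᶜ = (μ.mass : ℝ) -
      ∑ g ∈ Finset.range G, (μ {(g : ℝ)} : ℝ) := by
    rw [measureReal_compl hAm, h2, FiniteMeasure.measureReal_eq_coe_coeFn]
    rfl
  rw [← integral_add_compl hAm hf, h1, add_sub_cancel_left, ← h3, ← Real.norm_eq_abs]
  exact norm_setIntegral_le_of_norm_le_const (measure_lt_top _ _) fun x _ => f.norm_coe_le_norm x

/-- Scheffé's lemma for measures on `ℝ`, when the limit is carried by the natural numbers: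
convergence of the total mass prevents mass from escaping. -/
lemma tendsto_of_tendsto_singleton {σ : ℕ → FiniteMeasure ℝ} {ν : ProbabilityMeasure ℝ}
    (hν : HasSum (fun g : ℕ => (ν {(g : ℝ)} : ℝ)) 1)
    (hmass : Tendsto (fun n => ((σ n).mass : ℝ)) atTop (𝓝 1))
    (hg : ∀ g : ℕ, Tendsto (fun n => (σ n {(g : ℝ)} : ℝ)) atTop (𝓝 (ν {(g : ℝ)}))) :
    Tendsto σ atTop (𝓝 ν.toFiniteMeasure) := by
  rw [FiniteMeasure.tendsto_iff_forall_integral_tendsto]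
  intro f
  rw [Metric.tendsto_nhds]
  intro ε hε
  have h0 : Tendsto (fun G => ‖f‖ * (1 - ∑ g ∈ Finset.range G, (ν {(g : ℝ)} : ℝ))) atTop
      (𝓝 (‖f‖ * (1 - 1))) := (tendsto_const_nhds.sub hν.tendsto_sum_nat).const_mul _
  rw [sub_self, mul_zero] at h0
  obtain ⟨G, hG⟩ := (h0.eventually (gt_mem_nhds (show 0 < ε / 3 by positivity))).exists
  have h1 : Tendsto (fun n => ‖f‖ * (((σ n).mass : ℝ) -
      ∑ g ∈ Finset.range G, (σ n {(g : ℝ)} : ℝ))) atTop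
      (𝓝 (‖f‖ * (1 - ∑ g ∈ Finset.range G, (ν {(g : ℝ)} : ℝ)))) :=
    (hmass.sub (tendsto_finsetSum _ fun g _ => hg g)).const_mul _
  have h2 : Tendsto (fun n => ∑ g ∈ Finset.range G, f g * (σ n {(g : ℝ)} : ℝ)) atTop
      (𝓝 (∑ g ∈ Finset.range G, f g * (ν {(g : ℝ)} : ℝ))) :=
    tendsto_finsetSum _ fun g _ => (hg g).const_mul _
  have h3 := abs_integral_sub_sum_le ν.toFiniteMeasure f G
  rw [ProbabilityMeasure.mass_toFiniteMeasure] at h3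
  simp only [ProbabilityMeasure.coeFn_toFiniteMeasure, NNReal.coe_one] at h3
  filter_upwards [h1.eventually (gt_mem_nhds hG),
    (Metric.tendsto_nhds.1 h2) (ε / 3) (by positivity)] with n hn1 hn2
  have h4 := abs_integral_sub_sum_le (σ n) f G
  rw [Real.dist_eq] at hn2 ⊢
  rw [abs_lt] at hn2 ⊢
  rw [abs_le] at h3 h4
  constructor <;> linarith

/-- If the total mass and the point masses grow, on a common scale `s`, like the numbers of
summands and of gaps, then the normalized measures converge, weakly and on every atom. -/
lemma tendsto_normalized (hm : 1 ≤ m) {σ : ℕ → FiniteMeasure ℝ} {ν : ProbabilityMeasure ℝ}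
    (hν : ∀ g : ℕ, (ν {(g : ℝ)} : ℝ) = limitProb m g) {s : ℕ → ℝ} (hs : ∀ᶠ n in atTop, s n ≠ 0)
    (hmass : Tendsto (fun n => ((σ n).mass : ℝ) / s n) atTop (𝓝 (summandRate m)))
    (hg : ∀ g : ℕ, Tendsto (fun n => (σ n {(g : ℝ)} : ℝ) / s n) atTop (𝓝 (gapRate m g))) :
    Tendsto (fun n => (σ n).mass⁻¹ • σ n) atTop (𝓝 ν.toFiniteMeasure) ∧
      ∀ g : ℕ, Tendsto (fun n => ((σ n).mass⁻¹ • σ n) {(g : ℝ)}) atTop (𝓝 (ν {(g : ℝ)})) := by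
  have hr := (summandRate_pos hm).ne'
  have h0 : ∀ (r : ℝ) (A : Set ℝ), Tendsto (fun n => (σ n A : ℝ) / s n) atTop (𝓝 r) →
      Tendsto (fun n => (((σ n).mass⁻¹ • σ n) A : ℝ)) atTop (𝓝 (r / summandRate m)) := by
    intro r A hA
    refine (hA.div hmass hr).congr' ?_
    filter_upwards [hs] with n hn
    rw [Pi.div_apply, div_div_div_cancel_right₀ hn, FiniteMeasure.smul_apply,
      smul_eq_mul, NNReal.coe_mul, NNReal.coe_inv, inv_mul_eq_div]
  have h1 : ∀ g : ℕ, Tendsto (fun n => (((σ n).mass⁻¹ • σ n) {(g : ℝ)} : ℝ)) atTop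
      (𝓝 (ν {(g : ℝ)})) := fun g => by
    rw [hν]
    exact h0 _ _ (hg g)
  refine ⟨tendsto_of_tendsto_singleton ?_ ?_ h1, fun g => NNReal.tendsto_coe.1 (h1 g)⟩
  · simpa only [hν] using hasSum_limitProb hm
  · have h2 := h0 _ Set.univ hmass
    rwa [div_self hr] at h2

/-! ### The gap measures -/

lemma finiteMeasure_sum_apply {ι : Type*} (s : Finset ι) (σ : ι → FiniteMeasure ℝ) (A : Set ℝ) :
    (∑ i ∈ s, σ i) A = ∑ i ∈ s, σ i A := by
  classical
  induction s using Finset.induction_on with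
  | empty => simp
  | insert i s hi ih =>
    rw [Finset.sum_insert hi, Finset.sum_insert hi, FiniteMeasure.coeFn_add, Pi.add_apply, ih]

lemma gapSum_mass (m : ℕ) (a : ℕ → ℕ) (z : ℕ) :
    (gapSum m a z).mass = ((numSummands m a z - 1 : ℕ) : ℝ≥0) := by
  rw [gapSum, FiniteMeasure.mass, finiteMeasure_sum_apply]
  simp [card_consecutive, numSummands]

lemma gapSum_singleton (m : ℕ) (a : ℕ → ℕ) (z g : ℕ) :
    gapSum m a z {(g : ℝ)} = (gapCount m a g z : ℝ≥0) := by
  rw [gapSum, finiteMeasure_sum_apply, gapCount, Finset.card_filter, Nat.cast_sum]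
  refine Finset.sum_congr rfl fun p _ => ?_
  have hiff : (p.2 : ℝ) - p.1 = g ↔ p.2 = p.1 + g := by
    rw [sub_eq_iff_eq_add']
    exact_mod_cast Iff.rfl
  rw [ProbabilityMeasure.coeFn_toFiniteMeasure, ProbabilityMeasure.coeFn_def]
  simp only [diracProba_toMeasure_apply, Set.indicator_apply, Set.mem_singleton_iff, hiff,
    Pi.one_apply]
  split_ifs <;> simp

lemma gapMeasure_eq (m : ℕ) (a : ℕ → ℕ) (z : ℕ) :
    gapMeasure m a z = (gapSum m a z).mass⁻¹ • gapSum m a z := by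
  rw [gapMeasure, gapSum_mass]

lemma sum_gapSum_mass (m : ℕ) (a : ℕ → ℕ) (n : ℕ) :
    (∑ z ∈ Finset.Ico (a 0) (a (m * n + 1)), gapSum m a z).mass = (totalGaps m a n : ℝ≥0) := by
  rw [FiniteMeasure.mass, finiteMeasure_sum_apply, totalGaps, Nat.cast_sum]
  exact Finset.sum_congr rfl fun z _ => gapSum_mass m a z

lemma avgGapMeasure_eq (m : ℕ) (a : ℕ → ℕ) (n : ℕ) :
    avgGapMeasure m a n = (∑ z ∈ Finset.Ico (a 0) (a (m * n + 1)), gapSum m a z).mass⁻¹ •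
      ∑ z ∈ Finset.Ico (a 0) (a (m * n + 1)), gapSum m a z := by
  rw [avgGapMeasure, sum_gapSum_mass]

lemma gapProb_eq (m : ℕ) (a : ℕ → ℕ) (n g : ℕ) :
    gapProb m a n g = avgGapMeasure m a n {(g : ℝ)} := by
  rw [avgGapMeasure, FiniteMeasure.smul_apply, finiteMeasure_sum_apply, smul_eq_mul, gapProb]
  simp only [gapSum_singleton, gapCount]

lemma sum_Ico_eq_sum_range (hm : 1 ≤ m) (ha : IsMGonalSeq m a) (n : ℕ) {f : ℕ → ℝ}
    (hf : f 0 = 0) : ∑ z ∈ Finset.Ico (a 0) (a (m * n + 1)), f z =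
      ∑ z ∈ Finset.range (2 * (m + 1) ^ n), f z := by
  rw [ha.apply_mul_add_one hm, ha.zero_eq, Finset.range_eq_Ico,
    Finset.sum_eq_sum_Ico_succ_bot (a := 0) (b := 2 * (m + 1) ^ n) (by positivity), hf, zero_add]

lemma tendsto_avgGapMeasure (hm : 1 ≤ m) (ha : IsMGonalSeq m a) {ν : ProbabilityMeasure ℝ}
    (hν : ∀ g : ℕ, (ν {(g : ℝ)} : ℝ) = limitProb m g) :
    Tendsto (fun n => avgGapMeasure m a n) atTop (𝓝 ν.toFiniteMeasure) ∧
      ∀ g : ℕ, Tendsto (fun n => gapProb m a n g) atTop (𝓝 (ν {(g : ℝ)})) := by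
  simp only [gapProb_eq, avgGapMeasure_eq]
  refine tendsto_normalized hm hν (s := fun n => (2 * (m + 1) ^ n : ℕ) * n) ?_ ?_ fun g => ?_
  · filter_upwards [eventually_gt_atTop 0] with n hn
    positivity
  · refine ((summand_martingale hm ha).tendsto_average (summand_error m a)).congr fun n => ?_
    rw [sum_gapSum_mass, totalGaps, NNReal.coe_natCast, Nat.cast_sum,
      sum_Ico_eq_sum_range hm ha n (by simp [numSummands_zero hm ha])]
  · refine ((gap_martingale hm ha g).tendsto_average (gap_error m a g)).congr fun n => ?_
    rw [finiteMeasure_sum_apply, NNReal.coe_sum]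
    simp only [gapSum_singleton, NNReal.coe_natCast]
    rw [sum_Ico_eq_sum_range hm ha n (by simp [gapCount_zero hm ha])]

lemma ae_tendsto_gapMeasure (hm : 1 ≤ m) (ha : IsMGonalSeq m a) {ν : ProbabilityMeasure ℝ}
    (hν : ∀ g : ℕ, (ν {(g : ℝ)} : ℝ) = limitProb m g)
    {Ω : Type*} [MeasurableSpace Ω] {μ : Measure Ω} {Z : ℕ → Ω → ℕ}
    (hZ : ∀ n, 0 < n → HasLaw (Z n) (uniformOn (Set.Ico 0 (2 * (m + 1) ^ n))) μ) :
    ∀ᵐ ω ∂μ, Tendsto (fun n => gapMeasure m a (Z n ω)) atTop (𝓝 ν.toFiniteMeasure) := by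
  have h1 := (summand_martingale hm ha).ae_tendsto_rate one_pos (summand_error m a) hZ
  have h2 := ae_all_iff.2 fun g =>
    (gap_martingale hm ha g).ae_tendsto_rate (by norm_num) (gap_error m a g) hZ
  filter_upwards [h1, h2] with ω hω1 hω2
  simp only [gapMeasure_eq]
  refine (tendsto_normalized hm hν (s := fun n => (n : ℝ)) ?_ ?_ fun g => ?_).1
  · filter_upwards [eventually_gt_atTop 0] with n hn
    positivity
  · simpa only [gapSum_mass, NNReal.coe_natCast] using hω1
  · simpa only [gapSum_singleton, NNReal.coe_natCast] using hω2 g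

end MGonal

theorem theorem1p7 (m : ℕ) (hm : 1 ≤ m) (a : ℕ → ℕ) (ha : MGonal.IsMGonalSeq m a) :
    ∃ ν : ProbabilityMeasure ℝ,
      -- `ν` is the limiting average gap measure, with the limiting gap probabilities as masses
      Tendsto (fun n => MGonal.avgGapMeasure m a n) atTop (𝓝 ν.toFiniteMeasure) ∧
      (∀ g : ℕ, Tendsto (fun n => MGonal.gapProb m a n g) atTop (𝓝 (ν {(g : ℝ)}))) ∧
      -- almost sure convergence in distribution for uniformly distributed `Z n ∈ I_n`
      ∀ (Ω : Type*) [MeasurableSpace Ω] (μ : Measure Ω) [IsProbabilityMeasure μ]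
        (Z : ℕ → Ω → ℕ),
        (∀ n, 0 < n → HasLaw (Z n) (uniformOn (Set.Ico 0 (a (m * n + 1)))) μ) →
        ∀ᵐ ω ∂μ, Tendsto (fun n => MGonal.gapMeasure m a (Z n ω)) atTop (𝓝 ν.toFiniteMeasure) := by
  obtain ⟨ν, hν⟩ := MGonal.exists_probabilityMeasure_of_hasSum
    (MGonal.limitProb_nonneg hm) (MGonal.hasSum_limitProb hm)
  obtain ⟨h1, h2⟩ := MGonal.tendsto_avgGapMeasure hm ha hν
  refine ⟨ν, h1, h2, fun Ω _ μ _ Z hZ => ?_⟩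
  simp only [ha.apply_mul_add_one hm] at hZ
  exact MGonal.ae_tendsto_gapMeasure hm ha hν hZ
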